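/- A two-qubit state is a density matrix $\rho$ (positive semidefinite, trace one) on $\mathbb{C}^2\otimes\mathbb{C}^2$. With $|\Phi^+\rangle=(|00\rangle+|11\rangle)/\sqrt2$, its fully entangled fraction is $$F(\rho)=\max_{U,V}\ \langle\Phi^+|(U\otimes V)\,\rho\,(U\otimes V)^\dagger|\Phi^+\rangle ,$$ the maximum being over all unitary $2\times2$ matrices $U,V$. Its (CHSH-type) non-locality $NL[\rho]$ is the maximum of $$E_{0,0}+E_{0,1}+E_{1,0}-E_{1,1},\qquad E_{x,y}=P(0,0|x,y)+P(1,1|x,y)-P(0,1|x,y)-P(1,0|x,y),$$ over all behaviours $P(a,b|x,y)=\mathrm{Tr}\big((A^{x,a}\otimes B^{y,b})\rho\big)$, $a,b,x,y\in\{0,1\}$, where for every $x$ and $y$ the pairs $(A^{x,0},A^{x,1})$ and $(B^{y,0},B^{y,1})$ are two-outcome measurements of a qubit (positive semidefinite $2\times 2$ matrices with sum the identity). For $\alpha\in[0,1]$ let $$\Omega_\alpha=\alpha\,|\Phi^+\rangle\langle\Phi^+|+\tfrac{1-\alpha}{2}|00\rangle\langle00|+\tfrac{1-\alpha}{2}|11\rangle\langle11|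 .$$ **Proposition.** Let $\rho$ be an arbitrary two-qubit state. 1. If $\tfrac12\le F(\rho)\le1$, then $NL[\rho]\le 2\sqrt{1+(2F(\rho)-1)^2}$. 2. The states $\Omega_\alpha$ are maximally non-local for given fully entangled fraction: for every $\alpha\in[0,1]$, if $F(\Omega_\alpha)\ge F(\rho)$, then $NL[\Omega_\alpha]\ge NL[\rho]$. -/

import Mathlib

open scoped Matrix Kronecker ComplexOrder

noncomputable section

namespace TwoQubit

/-- Operators on a single qubit, in the computational basis. -/
abbrev QubitOp : Type := Matrix (Fin 2) (Fin 2) ℂ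

/-- Operators on two qubits, in the computational product basis `|ij⟩`. -/
abbrev TwoQubitOp : Type := Matrix (Fin 2 × Fin 2) (Fin 2 × Fin 2) ℂ

/-- A two-qubit (mixed) state: a density matrix. -/
structure IsState (ρ : TwoQubitOp) : Prop where
  posSemidef : ρ.PosSemidef
  trace_eq_one : ρ.trace = 1

/-- The vector `|ij⟩`. -/
def ket (i j : Fin 2) : Fin 2 × Fin 2 → ℂ := Pi.single (i, j) 1

/-- The operator `|ψ⟩⟨ψ|`. -/
def ketbra (ψ : Fin 2 × Fin 2 → ℂ) : TwoQubitOp := Matrix.vecMulVec ψ (star ψ)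

/-- The maximally entangled vector `|Φ⁺⟩ = (|00⟩ + |11⟩) / √2`. -/
def phiPlus : Fin 2 × Fin 2 → ℂ := ((1 / √2 : ℝ) : ℂ) • (ket 0 0 + ket 1 1)

/-- `⟨Φ⁺| (U ⊗ V) ρ (U ⊗ V)† |Φ⁺⟩`, a real number when `ρ` is Hermitian. -/
def overlap (ρ : TwoQubitOp) (U V : QubitOp) : ℝ :=
  (star phiPlus ⬝ᵥ (((U ⊗ₖ V) * ρ * (U ⊗ₖ V)ᴴ) *ᵥ phiPlus)).re

/-- All values of the overlap for local unitaries. -/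
def overlapValues (ρ : TwoQubitOp) : Set ℝ :=
  {r | ∃ U ∈ Matrix.unitaryGroup (Fin 2) ℂ, ∃ V ∈ Matrix.unitaryGroup (Fin 2) ℂ,
    r = overlap ρ U V}

/-- The fully entangled fraction
`F(ρ) = max_{U, V unitary} ⟨Φ⁺| (U ⊗ V) ρ (U ⊗ V)† |Φ⁺⟩`;
the supremum is a maximum, see `isGreatest_fullyEntangledFraction`. -/
def fullyEntangledFraction (ρ : TwoQubitOp) : ℝ := sSup (overlapValues ρ)

/-- A quantum measurement of a qubit with outcomes `0` and `1` (a two-outcome POVM;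
projective measurements are a special case). -/
structure IsMeasurement (M : Fin 2 → QubitOp) : Prop where
  posSemidef : ∀ a, (M a).PosSemidef
  sum_eq_one : ∑ a, M a = 1

/-- The behaviour `P(a, b | x, y) = Tr ((M_A^{x,a} ⊗ M_B^{y,b}) ρ)`, where Alice and Bob
measure `A x` and `B y`. -/
def behavior (ρ : TwoQubitOp) (A B : Fin 2 → Fin 2 → QubitOp) (a b x y : Fin 2) : ℝ :=
  (((A x a) ⊗ₖ (B y b)) * ρ).trace.re

/-- The correlation functions `E_{x,y}` of a behaviour `P a b x y = P(a, b | x, y)`. -/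
def correlation (P : Fin 2 → Fin 2 → Fin 2 → Fin 2 → ℝ) (x y : Fin 2) : ℝ :=
  P 0 0 x y + P 1 1 x y - P 0 1 x y - P 1 0 x y

/-- The CHSH value `E_{0,0} + E_{0,1} + E_{1,0} - E_{1,1}` of a behaviour. -/
def chsh (P : Fin 2 → Fin 2 → Fin 2 → Fin 2 → ℝ) : ℝ :=
  correlation P 0 0 + correlation P 0 1 + correlation P 1 0 - correlation P 1 1

/-- All CHSH values attainable by local two-outcome measurements on `ρ`. -/
def chshValues (ρ : TwoQubitOp) : Set ℝ :=
  {r | ∃ A B : Fin 2 → Fin 2 → QubitOp,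
    (∀ x, IsMeasurement (A x)) ∧ (∀ y, IsMeasurement (B y)) ∧ r = chsh (behavior ρ A B)}

/-- The non-locality `NL[ρ]`: the maximal CHSH value attainable from `ρ` by measurements;
the supremum is a maximum, see `isGreatest_nonLocality`. -/
def nonLocality (ρ : TwoQubitOp) : ℝ := sSup (chshValues ρ)

/-- `Ω_α = α |Φ⁺⟩⟨Φ⁺| + (1-α)/2 |00⟩⟨00| + (1-α)/2 |11⟩⟨11|`. -/
def Omega (α : ℝ) : TwoQubitOp :=
  (α : ℂ) • ketbra phiPlus + (((1 - α) / 2 : ℝ) : ℂ) • ketbra (ket 0 0)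
    + (((1 - α) / 2 : ℝ) : ℂ) • ketbra (ket 1 1)

theorem isState_Omega {α : ℝ} (h₀ : 0 ≤ α) (h₁ : α ≤ 1) : IsState (Omega α) := by
  have h₂ : 0 ≤ (1 - α) / 2 := by linarith
  have key : ∀ (c : ℝ) (ψ : Fin 2 × Fin 2 → ℂ), 0 ≤ c → ((c : ℂ) • ketbra ψ).PosSemidef := by
    intro c ψ hc
    refine Matrix.PosSemidef.smul (Matrix.posSemidef_vecMulVec_self_star ψ) ?_
    exact_mod_cast hc
  refine ⟨((key _ _ h₀).add (key _ _ h₂)).add (key _ _ h₂), ?_⟩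
  have hs : ((√2 : ℝ) : ℂ) * ((√2 : ℝ) : ℂ) = 2 := by
    rw [← Complex.ofReal_mul, Real.mul_self_sqrt (by norm_num)]; norm_num
  have hs' : ((√2 : ℝ) : ℂ)⁻¹ * ((√2 : ℝ) : ℂ)⁻¹ = 1 / 2 := by
    rw [← mul_inv, hs]; norm_num
  simp [Omega, ketbra, phiPlus, ket, Matrix.trace, Fintype.sum_prod_type, Matrix.vecMulVec_apply,
    Fin.sum_univ_two, Pi.single_apply, hs']
  ring

theorem isCompact_entries_le (n : Type*) :
    IsCompact {M : Matrix n n ℂ | ∀ i j, ‖M i j‖ ≤ 1} := by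
  have : {M : Matrix n n ℂ | ∀ i j, ‖M i j‖ ≤ 1}
      = Set.pi Set.univ fun _ : n => Set.pi Set.univ fun _ : n => Metric.closedBall (0 : ℂ) 1 := by
    refine Set.ext fun M => ⟨fun h i _ j _ => ?_, fun h i j => ?_⟩
    · simpa using h i j
    · simpa using h i trivial j trivial
  rw [this]
  exact isCompact_univ_pi fun _ => isCompact_univ_pi fun _ => isCompact_closedBall _ _

theorem isCompact_unitary :
    IsCompact {U : QubitOp | U ∈ Matrix.unitaryGroup (Fin 2) ℂ} := by
  refine (isCompact_entries_le (Fin 2)).of_isClosed_subset ?_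
    fun U hU i j => entry_norm_bound_of_unitary hU i j
  simp only [Matrix.mem_unitaryGroup_iff]
  exact isClosed_eq (by fun_prop) continuous_const

theorem isClosed_posSemidef : IsClosed {M : QubitOp | M.PosSemidef} := by
  simp only [Matrix.posSemidef_iff_dotProduct_mulVec, Set.ofPred_and, Set.ofPred_forall]
  refine IsClosed.inter ?_ (isClosed_iInter fun x => ?_)
  · exact isClosed_eq (by fun_prop) continuous_id
  · exact isClosed_le continuous_const (by fun_prop)

theorem entry_le_of_posSemidef {M : QubitOp} (h₀ : M.PosSemidef) (h₁ : (1 - M).PosSemidef)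
    (i j : Fin 2) : ‖M i j‖ ≤ 1 := by
  have hd : ∀ k, 0 ≤ (M k k).re ∧ (M k k).im = 0 ∧ (M k k).re ≤ 1 := by
    intro k
    have a := Complex.le_def.1 (h₀.diag_nonneg (i := k))
    have b := Complex.le_def.1 (h₁.diag_nonneg (i := k))
    simp at a b
    exact ⟨a.1, a.2.symm, by linarith [b.1]⟩
  have hdet := (Complex.le_def.1 h₀.det_nonneg).1
  have h10 : M 1 0 = star (M 0 1) := (h₀.1.apply 1 0).symm
  rw [Matrix.det_fin_two, h10] at hdet
  simp [(hd 0).2.1, (hd 1).2.1] at hdet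
  have hoff : ‖M 0 1‖ ≤ 1 := by
    have : ‖M 0 1‖ ^ 2 ≤ 1 := by
      rw [← Complex.normSq_eq_norm_sq, Complex.normSq_apply]
      nlinarith [hd 0, hd 1]
    nlinarith [norm_nonneg (M 0 1)]
  have hdiag : ∀ k, ‖M k k‖ ≤ 1 := by
    intro k
    have : M k k = ((M k k).re : ℂ) := Complex.ext (by simp) (by simp [(hd k).2.1])
    rw [this, Complex.norm_real, Real.norm_eq_abs, abs_of_nonneg (hd k).1]
    exact (hd k).2.2
  fin_cases i <;> fin_cases j
  · exact hdiag 0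
  · exact hoff
  · simpa [h10] using hoff
  · exact hdiag 1

theorem isCompact_measurement : IsCompact {M : Fin 2 → QubitOp | IsMeasurement M} := by
  refine (isCompact_univ_pi fun _ : Fin 2 => isCompact_entries_le (Fin 2)).of_isClosed_subset
    ?_ ?_
  · have : {M : Fin 2 → QubitOp | IsMeasurement M}
        = (⋂ a, {M | (M a).PosSemidef}) ∩ {M | ∑ a, M a = 1} := by
      ext M
      simp only [Set.mem_inter_iff, Set.mem_iInter, Set.mem_ofPred_eq]
      exact ⟨fun h => ⟨h.1, h.2⟩, fun h => ⟨h.1, h.2⟩⟩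
    rw [this]
    refine IsClosed.inter (isClosed_iInter fun a => ?_) (isClosed_eq (by fun_prop) continuous_const)
    have ha : Continuous fun M : Fin 2 → QubitOp => M a := continuous_apply a
    exact IsClosed.preimage ha isClosed_posSemidef
  · intro M hM a _
    have hsum := hM.sum_eq_one
    rw [Fin.sum_univ_two] at hsum
    refine entry_le_of_posSemidef (hM.posSemidef a) ?_
    fin_cases a
    · rw [← hsum]; simpa using hM.posSemidef 1
    · rw [← hsum]; simpa using hM.posSemidef 0

theorem isMeasurement_trivial : IsMeasurement ![(1 : QubitOp), 0] := by
  refine ⟨fun a => ?_, by simp⟩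
  fin_cases a
  · exact Matrix.PosSemidef.one
  · exact Matrix.PosSemidef.zero

/-- The maximum in the definition of the fully entangled fraction is attained. -/
theorem isGreatest_fullyEntangledFraction (ρ : TwoQubitOp) :
    IsGreatest (overlapValues ρ) (fullyEntangledFraction ρ) := by
  have himg : overlapValues ρ = (fun p : QubitOp × QubitOp => overlap ρ p.1 p.2) ''
      ({U | U ∈ Matrix.unitaryGroup (Fin 2) ℂ} ×ˢ {V | V ∈ Matrix.unitaryGroup (Fin 2) ℂ}) := by
    ext r
    constructor
    · rintro ⟨U, hU, V, hV, rfl⟩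
      exact ⟨(U, V), ⟨hU, hV⟩, rfl⟩
    · rintro ⟨⟨U, V⟩, ⟨hU, hV⟩, rfl⟩
      exact ⟨U, hU, V, hV, rfl⟩
  have hc : IsCompact (overlapValues ρ) := by
    rw [himg]
    refine (isCompact_unitary.prod isCompact_unitary).image ?_
    have hk : Continuous fun p : QubitOp × QubitOp => p.1 ⊗ₖ p.2 := by
      refine continuous_matrix fun i j => ?_
      simp only [Matrix.kroneckerMap_apply]
      fun_prop
    unfold overlap
    fun_prop
  exact hc.isGreatest_sSup ⟨_, 1, one_mem _, 1, one_mem _, rfl⟩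

/-- The maximum in the definition of the non-locality is attained. -/
theorem isGreatest_nonLocality (ρ : TwoQubitOp) :
    IsGreatest (chshValues ρ) (nonLocality ρ) := by
  let K : Set (Fin 2 → Fin 2 → QubitOp) := Set.pi Set.univ fun _ => {M | IsMeasurement M}
  have hK : IsCompact K := isCompact_univ_pi fun _ => isCompact_measurement
  have himg : chshValues ρ = (fun p : (Fin 2 → Fin 2 → QubitOp) × (Fin 2 → Fin 2 → QubitOp) =>
      chsh (behavior ρ p.1 p.2)) '' (K ×ˢ K) := by
    ext r
    constructor
    · rintro ⟨A, B, hA, hB, rfl⟩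
      exact ⟨(A, B), ⟨fun x _ => hA x, fun y _ => hB y⟩, rfl⟩
    · rintro ⟨⟨A, B⟩, ⟨hA, hB⟩, rfl⟩
      exact ⟨A, B, fun x => hA x trivial, fun y => hB y trivial, rfl⟩
  have hc : IsCompact (chshValues ρ) := by
    rw [himg]
    refine (hK.prod hK).image ?_
    have hb : ∀ a b x y, Continuous fun p : (Fin 2 → Fin 2 → QubitOp) × (Fin 2 → Fin 2 → QubitOp) =>
        behavior ρ p.1 p.2 a b x y := by
      intro a b x y
      have hk : Continuous fun p : (Fin 2 → Fin 2 → QubitOp) × (Fin 2 → Fin 2 → QubitOp) =>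
          (p.1 x a) ⊗ₖ (p.2 y b) := by
        refine continuous_matrix fun i j => ?_
        simp only [Matrix.kroneckerMap_apply]
        fun_prop
      unfold behavior
      fun_prop
    unfold chsh correlation
    fun_prop
  exact hc.isGreatest_sSup ⟨_, fun _ => ![1, 0], fun _ => ![1, 0],
    fun _ => isMeasurement_trivial, fun _ => isMeasurement_trivial, rfl⟩

end TwoQubit

end

/-! By multilinearity the observables in a CHSH expression may be taken extremal: `±1` or `n · σ`
with `n` a unit vector. If one of them is `±1`, positivity of probabilities gives the classical
bound 2. Otherwise everything depends on the correlation matrix `T`, through `⟪a₀, T (b₀ + b₁)⟫ +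
⟪a₁, T (b₀ - b₁)⟫`. Since `b₀ + b₁` and `b₀ - b₁` are orthogonal with squared norms summing to 4,
Cauchy–Schwarz reduces the bound to `‖T c‖² + ‖T c'‖² ≤ 1 + m²` for orthonormal `c, c'` (Horodecki
criterion).

The link with `F` is `expect_add_le_fullyEntangledFraction`: two correlations along orthonormal
pairs sum to at most `2F`. Local unitaries turn them into `ZZ + XX`, which equals twice the weight
of `Φ⁺` minus twice that of the singlet. After a rotation of `c, c'` that makes the images
orthogonal, this bounds the sum of their lengths by `2F ≤ 1 + m`; each length is at most 1, and the
bound on the squares follows.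

For `Ω_α` the correlation matrix is `diag(α, -α, 1)`, so explicit measurements reach `2√(1 + α²)`,
while `F(Ω_α) ≤ (1 + α)/2`. -/

noncomputable section

namespace TwoQubit

open scoped RealInnerProductSpace

/-! ### Bloch form of qubit observables and measurements -/

/-- The space of Bloch vectors. -/
abbrev BlochSpace : Type := EuclideanSpace ℝ (Fin 3)

/-- The observable `v · σ`, where `σ` is the vector of Pauli matrices. -/
def bloch : BlochSpace →ₗ[ℝ] QubitOp where
  toFun v := !![(v 2 : ℂ), v 0 - v 1 * Complex.I; v 0 + v 1 * Complex.I, -v 2]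
  map_add' v w := by
    ext i j
    fin_cases i <;> fin_cases j <;> simp <;> ring
  map_smul' c v := by
    ext i j
    fin_cases i <;> fin_cases j <;> simp <;> ring

theorem bloch_apply (v : BlochSpace) :
    bloch v = !![(v 2 : ℂ), v 0 - v 1 * Complex.I; v 0 + v 1 * Complex.I, -v 2] := rfl

theorem inner_eq_sum (v w : BlochSpace) : ⟪v, w⟫ = v 0 * w 0 + v 1 * w 1 + v 2 * w 2 := by
  simp [PiLp.inner_apply, Fin.sum_univ_three]
  ring

theorem norm_sq_eq_sum (v : BlochSpace) : ‖v‖ ^ 2 = v 0 ^ 2 + v 1 ^ 2 + v 2 ^ 2 := by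
  rw [← real_inner_self_eq_norm_sq, inner_eq_sum]
  ring

theorem conjTranspose_bloch (v : BlochSpace) : (bloch v)ᴴ = bloch v := by
  ext i j
  fin_cases i <;> fin_cases j <;> simp [bloch_apply, sub_eq_add_neg]

theorem bloch_mul_add_mul (v w : BlochSpace) :
    bloch v * bloch w + bloch w * bloch v = ((2 * ⟪v, w⟫ : ℝ) : ℂ) • 1 := by
  have hI := Complex.I_sq
  ext i j
  fin_cases i <;> fin_cases j <;>
    simp [bloch_apply, inner_eq_sum] <;>
    first
      | linear_combination (-2 * v 1 * w 1 : ℂ) * hI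
      | ring

theorem bloch_mul_self (v : BlochSpace) (hv : ‖v‖ = 1) : bloch v * bloch v = 1 := by
  have h := bloch_mul_add_mul v v
  rw [real_inner_self_eq_norm_sq, hv, ← two_smul ℂ] at h
  refine smul_right_injective _ (two_ne_zero (α := ℂ)) ?_
  simpa using h

theorem posSemidef_one_add_of_mul_self_eq_one {A : QubitOp} (hA : Aᴴ = A) (h : A * A = 1) :
    (1 + A).PosSemidef := by
  -- For a Hermitian involution, `(1 + A)² = 2 (1 + A)`.
  have : 1 + A = ((1 / 2 : ℝ) : ℂ) • ((1 + A)ᴴ * (1 + A)) := by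
    rw [Matrix.conjTranspose_add, Matrix.conjTranspose_one, hA, add_mul, mul_add, mul_add, h]
    simp only [mul_one, one_mul]
    rw [add_comm A 1, ← two_smul ℂ (1 + A), smul_smul]
    norm_num
  rw [this]
  refine (Matrix.posSemidef_conjTranspose_mul_self _).smul ?_
  exact_mod_cast (by norm_num : (0 : ℝ) ≤ 1 / 2)

theorem posSemidef_one_add_bloch {v : BlochSpace} (hv : ‖v‖ = 1) : (1 + bloch v).PosSemidef :=
  posSemidef_one_add_of_mul_self_eq_one (conjTranspose_bloch v) (bloch_mul_self v hv)

/-- The determinant is `s² - ‖v‖²` and the trace `2s`; both are nonnegative. -/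
theorem norm_le_of_posSemidef {s : ℝ} {v : BlochSpace}
    (h : ((s : ℂ) • (1 : QubitOp) + bloch v).PosSemidef) : ‖v‖ ≤ s := by
  have hd := (Complex.le_def.1 h.det_nonneg).1
  have ht := (Complex.le_def.1 h.trace_nonneg).1
  simp [Matrix.det_fin_two, Matrix.trace_fin_two, bloch_apply] at hd ht
  refine abs_le_of_sq_le_sq' ?_ (by linarith) |>.2
  rw [norm_sq_eq_sum]
  nlinarith

/-- A Hermitian operator in Bloch form. -/
theorem exists_bloch_of_isHermitian {A : QubitOp} (hA : A.IsHermitian) :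
    ∃ (s : ℝ) (v : BlochSpace), A = (s : ℂ) • 1 + bloch v := by
  have h00 := congrArg Complex.im (hA.apply 0 0)
  have h11 := congrArg Complex.im (hA.apply 1 1)
  have h10 := hA.apply 1 0
  simp at h00 h11
  refine ⟨((A 0 0).re + (A 1 1).re) / 2,
    !₂[(A 0 1).re, -(A 0 1).im, ((A 0 0).re - (A 1 1).re) / 2], ?_⟩
  ext i j
  fin_cases i <;> fin_cases j <;> simp [bloch_apply, Complex.ext_iff, ← h10]
  · constructor
    · ring
    · linarith
  · constructor
    · ring
    · linarith

/-- The observable of a measurement in Bloch form. -/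
theorem IsMeasurement.exists_bloch {M : Fin 2 → QubitOp} (hM : IsMeasurement M) :
    ∃ (s : ℝ) (v : BlochSpace), M 0 - M 1 = (s : ℂ) • 1 + bloch v ∧ |s| + ‖v‖ ≤ 1 := by
  have hsum := hM.sum_eq_one
  rw [Fin.sum_univ_two] at hsum
  obtain ⟨s, v, h⟩ := exists_bloch_of_isHermitian ((hM.posSemidef 0).1.sub (hM.posSemidef 1).1)
  refine ⟨s, v, h, ?_⟩
  have h₀ : ‖v‖ ≤ 1 + s := by
    refine norm_le_of_posSemidef ?_
    have : ((1 + s : ℝ) : ℂ) • (1 : QubitOp) + bloch v = M 0 + M 0 := by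
      push_cast
      rw [add_smul, one_smul, add_assoc, ← h, ← hsum]
      abel
    rw [this]
    exact (hM.posSemidef 0).add (hM.posSemidef 0)
  have h₁ : ‖-v‖ ≤ 1 - s := by
    refine norm_le_of_posSemidef ?_
    have : ((1 - s : ℝ) : ℂ) • (1 : QubitOp) + bloch (-v) = M 1 + M 1 := by
      push_cast
      rw [sub_smul, one_smul, map_neg, ← sub_eq_add_neg, sub_sub, ← h, ← hsum]
      abel
    rw [this]
    exact (hM.posSemidef 1).add (hM.posSemidef 1)
  rw [norm_neg] at h₁
  rcases abs_cases s with hs | hs <;> linarith [hs.1]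

/-! ### Reduction to extremal observables -/

/-- A two-outcome observable that is deterministic or projective. -/
def IsExtremal (A : QubitOp) : Prop :=
  A = 1 ∨ A = -1 ∨ ∃ n : BlochSpace, ‖n‖ = 1 ∧ A = bloch n

theorem IsExtremal.neg {A : QubitOp} (hA : IsExtremal A) : IsExtremal (-A) := by
  rcases hA with rfl | rfl | ⟨n, hn, rfl⟩
  · exact Or.inr (Or.inl rfl)
  · exact Or.inl (neg_neg 1)
  · exact Or.inr (Or.inr ⟨-n, by rwa [norm_neg], (map_neg bloch n).symm⟩)

theorem IsExtremal.posSemidef_one_add {A : QubitOp} (hA : IsExtremal A) :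
    (1 + A).PosSemidef := by
  rcases hA with rfl | rfl | ⟨n, hn, rfl⟩
  · exact Matrix.PosSemidef.one.add Matrix.PosSemidef.one
  · simpa using Matrix.PosSemidef.zero
  · exact posSemidef_one_add_bloch hn

/-- The observables with `|s| + ‖v‖ ≤ 1` are convex combinations of extremal ones, and a linear
functional on a convex hull is dominated by its value at some generator. -/
theorem exists_isExtremal_ge (f : QubitOp →ₗ[ℝ] ℝ) {s : ℝ} {v : BlochSpace}
    (h : |s| + ‖v‖ ≤ 1) :
    ∃ A, IsExtremal A ∧ f ((s : ℂ) • 1 + bloch v) ≤ f A := by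
  obtain ⟨n, hn, hv⟩ : ∃ n : BlochSpace, ‖n‖ = 1 ∧ v = ‖v‖ • n := by
    rcases eq_or_ne v 0 with rfl | hv
    · exact ⟨EuclideanSpace.single 0 1, by simp, by simp⟩
    · exact ⟨‖v‖⁻¹ • v, norm_smul_inv_norm hv, by simp [smul_smul, hv]⟩
  have hE : IsExtremal (bloch n) := Or.inr (Or.inr ⟨n, hn, rfl⟩)
  have hO : IsExtremal 1 := Or.inl rfl
  have abs_attained : ∀ A, IsExtremal A → ∃ A', IsExtremal A' ∧ |f A| = f A' := by
    intro A hA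
    rcases abs_choice (f A) with h | h
    · exact ⟨A, hA, h⟩
    · exact ⟨-A, hA.neg, by rw [h, map_neg]⟩
  have hval : f ((s : ℂ) • 1 + bloch v) ≤ |s| * |f 1| + ‖v‖ * |f (bloch n)| := by
    have : ((s : ℂ) • 1 + bloch v : QubitOp) = s • 1 + ‖v‖ • bloch n := by
      conv_lhs => rw [hv]
      rw [map_smul, Complex.coe_smul]
    rw [this, map_add, map_smul, map_smul, smul_eq_mul, smul_eq_mul]
    refine add_le_add ?_ (mul_le_mul_of_nonneg_left (le_abs_self _) (norm_nonneg v))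
    rw [← abs_mul]
    exact le_abs_self _
  rcases le_total |f 1| |f (bloch n)| with hle | hle
  · obtain ⟨A', hA', hf⟩ := abs_attained _ hE
    refine ⟨A', hA', hf ▸ hval.trans ?_⟩
    nlinarith [abs_nonneg s, norm_nonneg v, abs_nonneg (f (bloch n)), abs_nonneg (f 1)]
  · obtain ⟨A', hA', hf⟩ := abs_attained _ hO
    refine ⟨A', hA', hf ▸ hval.trans ?_⟩
    nlinarith [abs_nonneg s, norm_nonneg v, abs_nonneg (f (bloch n)), abs_nonneg (f 1)]

/-- The expectation value `Re Tr ((A ⊗ B) ρ)`. -/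
def expect (ρ : TwoQubitOp) : QubitOp →ₗ[ℝ] QubitOp →ₗ[ℝ] ℝ :=
  LinearMap.mk₂ ℝ (fun A B => ((A ⊗ₖ B) * ρ).trace.re)
    (fun A A' B => by simp [Matrix.add_kronecker, add_mul])
    (fun c A B => by simp [Matrix.smul_kronecker])
    (fun A B B' => by simp [Matrix.kronecker_add, add_mul])
    (fun c A B => by simp [Matrix.kronecker_smul])

theorem expect_apply (ρ : TwoQubitOp) (A B : QubitOp) :
    expect ρ A B = ((A ⊗ₖ B) * ρ).trace.re := rfl

theorem expect_one_one {ρ : TwoQubitOp} (hρ : IsState ρ) : expect ρ 1 1 = 1 := by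
  simp [expect_apply, hρ.trace_eq_one]

open scoped MatrixOrder in
theorem trace_mul_nonneg {n : Type*} [Fintype n] [DecidableEq n] {P Q : Matrix n n ℂ}
    (hP : P.PosSemidef) (hQ : Q.PosSemidef) : 0 ≤ (P * Q).trace := by
  obtain ⟨C, rfl⟩ := CStarAlgebra.nonneg_iff_eq_star_mul_self.1 hQ.nonneg
  rw [Matrix.star_eq_conjTranspose, ← Matrix.mul_assoc, Matrix.trace_mul_comm, ← Matrix.mul_assoc]
  exact (hP.mul_mul_conjTranspose_same C).trace_nonneg

theorem expect_nonneg {ρ : TwoQubitOp} (hρ : IsState ρ) {A B : QubitOp} (hA : A.PosSemidef)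
    (hB : B.PosSemidef) : 0 ≤ expect ρ A B :=
  (Complex.le_def.1 (trace_mul_nonneg (hA.kronecker hB) hρ.posSemidef)).1

theorem correlation_behavior (ρ : TwoQubitOp) (A B : Fin 2 → Fin 2 → QubitOp) (x y : Fin 2) :
    correlation (behavior ρ A B) x y = expect ρ (A x 0 - A x 1) (B y 0 - B y 1) := by
  have : ∀ a b, behavior ρ A B a b x y = expect ρ (A x a) (B y b) := fun _ _ => rfl
  simp only [correlation, this, map_sub, LinearMap.sub_apply]
  ring

/-- The CHSH value for given observables. -/
def chshExpect (ρ : TwoQubitOp) (A₀ A₁ B₀ B₁ : QubitOp) : ℝ :=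
  expect ρ A₀ B₀ + expect ρ A₀ B₁ + expect ρ A₁ B₀ - expect ρ A₁ B₁

/-- Each expression is four times the probability of one pair of outcomes, the expectation of `(1 ±
A) ⊗ (1 ± B)`. -/
theorem expect_extremal_bounds {ρ : TwoQubitOp} (hρ : IsState ρ) {A B : QubitOp}
    (hA : IsExtremal A) (hB : IsExtremal B) :
    0 ≤ 1 + expect ρ A 1 + expect ρ 1 B + expect ρ A B ∧
    0 ≤ 1 + expect ρ A 1 - expect ρ 1 B - expect ρ A B ∧
    0 ≤ 1 - expect ρ A 1 + expect ρ 1 B - expect ρ A B ∧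
    0 ≤ 1 - expect ρ A 1 - expect ρ 1 B + expect ρ A B := by
  have key : ∀ A B, IsExtremal A → IsExtremal B →
      0 ≤ 1 + expect ρ A 1 + expect ρ 1 B + expect ρ A B := by
    intro A B hA hB
    have := expect_nonneg hρ hA.posSemidef_one_add hB.posSemidef_one_add
    simp only [map_add, LinearMap.add_apply, expect_one_one hρ] at this
    linarith
  have h₁ := key A (-B) hA hB.neg
  have h₂ := key (-A) B hA.neg hB
  have h₃ := key (-A) (-B) hA.neg hB.neg
  simp only [map_neg, LinearMap.neg_apply] at h₁ h₂ h₃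
  refine ⟨key A B hA hB, ?_, ?_, ?_⟩ <;> linarith

theorem abs_expect_le_one {ρ : TwoQubitOp} (hρ : IsState ρ) {A B : QubitOp}
    (hA : IsExtremal A) (hB : IsExtremal B) : |expect ρ A B| ≤ 1 := by
  obtain ⟨h₁, h₂, h₃, h₄⟩ := expect_extremal_bounds hρ hA hB
  rw [abs_le]
  constructor <;> linarith

/-- With a deterministic observable the classical bound holds; otherwise all observables are
given by Bloch vectors of norm one. -/
theorem chshExpect_le_two_or {ρ : TwoQubitOp} (hρ : IsState ρ) {A₀ A₁ B₀ B₁ : QubitOp}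
    (hA₀ : IsExtremal A₀) (hA₁ : IsExtremal A₁) (hB₀ : IsExtremal B₀) (hB₁ : IsExtremal B₁) :
    chshExpect ρ A₀ A₁ B₀ B₁ ≤ 2 ∨ ∃ a₀ a₁ b₀ b₁ : BlochSpace,
      ‖a₀‖ = 1 ∧ ‖a₁‖ = 1 ∧ ‖b₀‖ = 1 ∧ ‖b₁‖ = 1 ∧
      A₀ = bloch a₀ ∧ A₁ = bloch a₁ ∧ B₀ = bloch b₀ ∧ B₁ = bloch b₁ := by
  have h₀₀ := expect_extremal_bounds hρ hA₀ hB₀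
  have h₀₁ := expect_extremal_bounds hρ hA₀ hB₁
  have h₁₀ := expect_extremal_bounds hρ hA₁ hB₀
  have h₁₁ := expect_extremal_bounds hρ hA₁ hB₁
  have h := expect_one_one hρ
  unfold chshExpect
  rcases hA₀ with rfl | rfl | ⟨a₀, ha₀, rfl⟩
  -- For `A₀ = 1`, the CHSH bound is the sum of two positivity constraints, one for `(A₁, B₀)` and
  -- one for `(A₁, B₁)`; the other deterministic cases are analogous.
  · left; linarith
  · left
    simp only [map_neg, LinearMap.neg_apply] at *
    linarith
  rcases hA₁ with rfl | rfl | ⟨a₁, ha₁, rfl⟩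
  · left; linarith
  · left
    simp only [map_neg, LinearMap.neg_apply] at *
    linarith
  rcases hB₀ with rfl | rfl | ⟨b₀, hb₀, rfl⟩
  · left; linarith
  · left
    simp only [map_neg] at *
    linarith
  rcases hB₁ with rfl | rfl | ⟨b₁, hb₁, rfl⟩
  · left; linarith
  · left
    simp only [map_neg] at *
    linarith
  exact Or.inr ⟨a₀, a₁, b₀, b₁, ha₀, ha₁, hb₀, hb₁, rfl, rfl, rfl, rfl⟩

/-- Every CHSH value is bounded by one for extremal observables. -/
theorem exists_chshExpect_ge {ρ : TwoQubitOp} {r : ℝ} (hr : r ∈ chshValues ρ) :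
    ∃ A₀ A₁ B₀ B₁, IsExtremal A₀ ∧ IsExtremal A₁ ∧ IsExtremal B₀ ∧ IsExtremal B₁ ∧
      r ≤ chshExpect ρ A₀ A₁ B₀ B₁ := by
  obtain ⟨A, B, hA, hB, rfl⟩ := hr
  obtain ⟨s₀, v₀, hv₀, hs₀⟩ := (hA 0).exists_bloch
  obtain ⟨s₁, v₁, hv₁, hs₁⟩ := (hA 1).exists_bloch
  obtain ⟨t₀, w₀, hw₀, ht₀⟩ := (hB 0).exists_bloch
  obtain ⟨t₁, w₁, hw₁, ht₁⟩ := (hB 1).exists_bloch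
  simp only [chsh, correlation_behavior]
  rw [hv₀, hv₁, hw₀, hw₁]
  -- Bob's observables stay fixed while Alice's are replaced by extremal ones; then Bob's are
  -- replaced with Alice's new ones fixed.
  generalize hY₀ : ((t₀ : ℂ) • 1 + bloch w₀ : QubitOp) = Y₀
  generalize hY₁ : ((t₁ : ℂ) • 1 + bloch w₁ : QubitOp) = Y₁
  obtain ⟨A₀, hA₀, h₀⟩ := exists_isExtremal_ge ((expect ρ).flip (Y₀ + Y₁)) hs₀
  obtain ⟨A₁, hA₁, h₁⟩ := exists_isExtremal_ge ((expect ρ).flip (Y₀ - Y₁)) hs₁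
  obtain ⟨B₀, hB₀, h₂⟩ := exists_isExtremal_ge (expect ρ (A₀ + A₁)) ht₀
  obtain ⟨B₁, hB₁, h₃⟩ := exists_isExtremal_ge (expect ρ (A₀ - A₁)) ht₁
  refine ⟨A₀, A₁, B₀, B₁, hA₀, hA₁, hB₀, hB₁, ?_⟩
  rw [hY₀] at h₂
  rw [hY₁] at h₃
  rw [LinearMap.flip_apply, LinearMap.flip_apply] at h₀ h₁
  rw [map_add (expect ρ _) Y₀, map_add (expect ρ A₀) Y₀] at h₀
  rw [map_sub (expect ρ _) Y₀, map_sub (expect ρ A₁) Y₀] at h₁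
  rw [map_add, LinearMap.add_apply, LinearMap.add_apply] at h₂
  rw [map_sub, LinearMap.sub_apply, LinearMap.sub_apply] at h₃
  unfold chshExpect
  linarith

/-! ### Euclidean geometry of the correlation matrix -/

/-- An orthonormal pair can be rotated in its plane so that its images under a linear map become
orthogonal. -/
theorem exists_orthonormal_pair_map_orthogonal {V : Type*} [NormedAddCommGroup V]
    [InnerProductSpace ℝ V] (T : V →ₗ[ℝ] V) {c c' : V} (hc : ‖c‖ = 1) (hc' : ‖c'‖ = 1)
    (hcc' : ⟪c, c'⟫ = 0) :
    ∃ d d' : V, ‖d‖ = 1 ∧ ‖d'‖ = 1 ∧ ⟪d, d'⟫ = 0 ∧ ⟪T d, T d'⟫ = 0 ∧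
      ‖T d‖ ^ 2 + ‖T d'‖ ^ 2 = ‖T c‖ ^ 2 + ‖T c'‖ ^ 2 := by
  have expand : ∀ (u w : V) (p q r s : ℝ), ⟪p • u + q • w, r • u + s • w⟫
      = p * r * ‖u‖ ^ 2 + q * s * ‖w‖ ^ 2 + (p * s + q * r) * ⟪u, w⟫ := by
    intro u w p q r s
    simp only [inner_add_left, inner_add_right, real_inner_smul_left, real_inner_smul_right,
      real_inner_self_eq_norm_sq, real_inner_comm u w]
    ring
  obtain ⟨φ, hφ⟩ : ∃ φ : ℝ, ⟪Real.cos φ • T c + Real.sin φ • T c',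
      (-Real.sin φ) • T c + Real.cos φ • T c'⟫ = 0 := by
    -- A quarter turn reverses the sign of this inner product, so it vanishes at some angle in
    -- between.
    let g : ℝ → ℝ := fun φ => ⟪Real.cos φ • T c + Real.sin φ • T c',
      (-Real.sin φ) • T c + Real.cos φ • T c'⟫
    have hg : Continuous g := by fun_prop
    have h₀ : g 0 = ⟪T c, T c'⟫ := by simp [g]
    have h₁ : g (Real.pi / 2) = -⟪T c, T c'⟫ := by simp [g, real_inner_comm]
    have hmem : (0 : ℝ) ∈ Set.uIcc (g 0) (g (Real.pi / 2)) := by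
      rw [h₀, h₁, Set.mem_uIcc]
      rcases le_total ⟪T c, T c'⟫ 0 with h | h
      · exact Or.inl ⟨h, by linarith⟩
      · exact Or.inr ⟨by linarith, h⟩
    obtain ⟨φ, -, h⟩ := intermediate_value_uIcc hg.continuousOn hmem
    exact ⟨φ, h⟩
  have hcs := Real.sin_sq_add_cos_sq φ
  refine ⟨Real.cos φ • c + Real.sin φ • c', (-Real.sin φ) • c + Real.cos φ • c', ?_, ?_, ?_, ?_, ?_⟩
  · rw [← sq_eq_sq₀ (norm_nonneg _) zero_le_one, ← real_inner_self_eq_norm_sq, expand, hc, hc',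
      hcc']
    linear_combination hcs
  · rw [← sq_eq_sq₀ (norm_nonneg _) zero_le_one, ← real_inner_self_eq_norm_sq, expand, hc, hc',
      hcc']
    linear_combination hcs
  · rw [expand, hc, hc', hcc']
    ring
  · simpa only [map_add, map_smul] using hφ
  · simp only [map_add, map_smul]
    rw [← real_inner_self_eq_norm_sq, ← real_inner_self_eq_norm_sq, expand, expand]
    linear_combination (‖T c‖ ^ 2 + ‖T c'‖ ^ 2) * hcs

/-- Criterion for the sum of squared lengths of the images of an orthonormal pair. -/
theorem norm_sq_map_add_norm_sq_map_le {V : Type*} [NormedAddCommGroup V]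
    [InnerProductSpace ℝ V] (T : V →ₗ[ℝ] V) {m : ℝ} (hm : 0 ≤ m)
    (hT : ∀ d, ‖d‖ = 1 → ‖T d‖ ≤ 1)
    (hm' : ∀ a a' d d' : V, ‖a‖ = 1 → ‖a'‖ = 1 → ⟪a, a'⟫ = 0 → ‖d‖ = 1 → ‖d'‖ = 1 → ⟪d, d'⟫ = 0 →
      ⟪a, T d⟫ + ⟪a', T d'⟫ ≤ 1 + m)
    {c c' : V} (hc : ‖c‖ = 1) (hc' : ‖c'‖ = 1) (hcc' : ⟪c, c'⟫ = 0) :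
    ‖T c‖ ^ 2 + ‖T c'‖ ^ 2 ≤ 1 + m ^ 2 := by
  obtain ⟨d, d', hd, hd', hdd', hTdd', hsum⟩ :=
    exists_orthonormal_pair_map_orthogonal T hc hc' hcc'
  rw [← hsum]
  have h₁ := hT d hd
  have h₂ := hT d' hd'
  rcases eq_or_ne (T d) 0 with h | h
  · rw [h, norm_zero]
    nlinarith [norm_nonneg (T d')]
  rcases eq_or_ne (T d') 0 with h' | h'
  · rw [h', norm_zero]
    nlinarith [norm_nonneg (T d)]
  have hn := norm_ne_zero_iff.2 h
  have hn' := norm_ne_zero_iff.2 h'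
  -- The normalized images form an orthonormal pair; testing against them yields `‖T d‖ + ‖T d'‖ ≤ 1
  -- + m`.
  have key := hm' (‖T d‖⁻¹ • T d) (‖T d'‖⁻¹ • T d') d d' (norm_smul_inv_norm h)
    (norm_smul_inv_norm h') (by simp [real_inner_smul_left, real_inner_smul_right, hTdd'])
    hd hd' hdd'
  rw [real_inner_smul_left, real_inner_smul_left, real_inner_self_eq_norm_sq,
    real_inner_self_eq_norm_sq, pow_two, pow_two, inv_mul_cancel_left₀ hn,
    inv_mul_cancel_left₀ hn'] at key
  have hp := norm_nonneg (T d)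
  have hq := norm_nonneg (T d')
  -- With `p, q` the two lengths, `(1 - p)(1 - q) ≥ 0` gives `p² + q² ≤ 1 + (p + q - 1)²`, which is
  -- useful when `p + q ≥ 1`; otherwise `p² + q² ≤ 1`.
  rcases le_total (‖T d‖ + ‖T d'‖) 1 with hle | hle
  · nlinarith
  · nlinarith [mul_nonneg (sub_nonneg.2 h₁) (sub_nonneg.2 h₂)]

/-- The CHSH bound for projective observables. -/
theorem inner_map_add_sub_le {V : Type*} [NormedAddCommGroup V] [InnerProductSpace ℝ V]
    (T : V →ₗ[ℝ] V) {C : ℝ} (hC : 1 ≤ C) (hT : ∀ d, ‖d‖ = 1 → ‖T d‖ ≤ 1)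
    (hT' : ∀ c c' : V, ‖c‖ = 1 → ‖c'‖ = 1 → ⟪c, c'⟫ = 0 → ‖T c‖ ^ 2 + ‖T c'‖ ^ 2 ≤ C)
    {a₀ a₁ b₀ b₁ : V} (ha₀ : ‖a₀‖ = 1) (ha₁ : ‖a₁‖ = 1) (hb₀ : ‖b₀‖ = 1) (hb₁ : ‖b₁‖ = 1) :
    ⟪a₀, T (b₀ + b₁)⟫ + ⟪a₁, T (b₀ - b₁)⟫ ≤ 2 * √C := by
  have bound : ⟪a₀, T (b₀ + b₁)⟫ + ⟪a₁, T (b₀ - b₁)⟫ ≤ ‖T (b₀ + b₁)‖ + ‖T (b₀ - b₁)‖ := by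
    have h₀ := real_inner_le_norm a₀ (T (b₀ + b₁))
    have h₁ := real_inner_le_norm a₁ (T (b₀ - b₁))
    rw [ha₀, one_mul] at h₀
    rw [ha₁, one_mul] at h₁
    exact add_le_add h₀ h₁
  refine bound.trans ?_
  have horth : ⟪b₀ + b₁, b₀ - b₁⟫ = 0 := by
    rw [inner_add_left, inner_sub_right, inner_sub_right, real_inner_self_eq_norm_sq,
      real_inner_self_eq_norm_sq, hb₀, hb₁, real_inner_comm]
    ring
  have hpar := parallelogram_law_with_norm ℝ b₀ b₁
  rw [hb₀, hb₁] at hpar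
  generalize b₀ + b₁ = u at *
  generalize b₀ - b₁ = w at *
  have hsq : 1 ≤ √C := Real.one_le_sqrt.2 hC
  have map_le : ∀ x : V, ‖T x‖ ≤ ‖x‖ := by
    intro x
    rcases eq_or_ne x 0 with rfl | hx
    · simp
    have h := hT _ (norm_smul_inv_norm (𝕜 := ℝ) hx)
    have hpos := norm_pos_iff.2 hx
    simp only [RCLike.ofReal_real_eq_id, id_eq, map_smul, norm_smul, norm_inv, norm_norm] at h
    rwa [inv_mul_le_iff₀ hpos, mul_one] at h
  have hu := norm_nonneg u
  have hw := norm_nonneg w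
  rcases eq_or_ne u 0 with rfl | hu0
  · have := map_le w
    rw [map_zero, norm_zero] at *
    nlinarith
  rcases eq_or_ne w 0 with rfl | hw0
  · have := map_le u
    rw [map_zero, norm_zero] at *
    nlinarith
  have h := hT' (‖u‖⁻¹ • u) (‖w‖⁻¹ • w) (norm_smul_inv_norm hu0) (norm_smul_inv_norm hw0)
    (by simp [real_inner_smul_left, real_inner_smul_right, horth])
  simp only [map_smul, norm_smul, norm_inv, norm_norm] at h
  have hu' := norm_ne_zero_iff.2 hu0
  have hw' := norm_ne_zero_iff.2 hw0
  have hTu : ‖T u‖ = ‖u‖ * (‖u‖⁻¹ * ‖T u‖) := (mul_inv_cancel_left₀ hu' _).symm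
  have hTw : ‖T w‖ = ‖w‖ * (‖w‖⁻¹ * ‖T w‖) := (mul_inv_cancel_left₀ hw' _).symm
  rw [hTu, hTw]
  generalize ‖u‖⁻¹ * ‖T u‖ = p at *
  generalize ‖w‖⁻¹ * ‖T w‖ = q at *
  have h4 : (2 : ℝ) = √4 := by
    rw [show (4 : ℝ) = 2 ^ 2 by norm_num, Real.sqrt_sq (by norm_num)]
  rw [h4, ← Real.sqrt_mul (by norm_num)]
  refine Real.le_sqrt_of_sq_le ?_
  -- Cauchy–Schwarz: `(‖u‖ p + ‖w‖ q)² ≤ (‖u‖² + ‖w‖²)(p² + q²) ≤ 4C`.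
  nlinarith [sq_nonneg (‖u‖ * q - ‖w‖ * p)]

/-! ### Correlations, local unitaries and the overlap with `Φ⁺` -/

/-- The correlation matrix of a two-qubit operator. -/
theorem exists_correlationMap (ρ : TwoQubitOp) : ∃ T : BlochSpace →ₗ[ℝ] BlochSpace,
    ∀ x y, expect ρ (bloch x) (bloch y) = ⟪x, T y⟫ := by
  let b := EuclideanSpace.basisFun (Fin 3) ℝ
  refine ⟨∑ i, ((expect ρ (bloch (b i))).comp bloch).smulRight (b i), fun x y => ?_⟩
  conv_lhs => rw [← b.sum_repr' x]
  simp [map_sum, inner_sum, real_inner_smul_right, real_inner_comm, mul_comm]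

/-- A pair of orthonormal Bloch vectors is unitarily equivalent to the third and first basis
vectors. -/
theorem exists_unitary_conj_eq_bloch {a a' : BlochSpace} (ha : ‖a‖ = 1) (ha' : ‖a'‖ = 1)
    (h : ⟪a, a'⟫ = 0) : ∃ U ∈ Matrix.unitaryGroup (Fin 2) ℂ,
      Uᴴ * !![1, 0; 0, -1] * U = bloch a ∧ Uᴴ * !![0, 1; 1, 0] * U = bloch a' := by
  have hA := conjTranspose_bloch a
  have hA' := conjTranspose_bloch a'
  have hsq := bloch_mul_self a ha
  have hsq' := bloch_mul_self a' ha'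
  have hanti : bloch a * bloch a' = -(bloch a' * bloch a) := by
    have := bloch_mul_add_mul a a'
    rw [h] at this
    refine eq_neg_of_add_eq_zero_left ?_
    simpa using this
  have hdet : (1 - bloch a).det = 0 := by
    have hn := norm_sq_eq_sum a
    rw [ha] at hn
    have hn' : (1 : ℂ) = a 0 ^ 2 + a 1 ^ 2 + a 2 ^ 2 := by exact_mod_cast (by simpa using hn)
    simp [Matrix.det_fin_two, bloch_apply]
    linear_combination hn' + (a 1 : ℂ) ^ 2 * Complex.I_sq
  generalize bloch a = A at *
  generalize bloch a' = A' at *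
  -- If `e` is a unit vector with `A e = e`, anticommutation makes `A' e` an eigenvector for `-1`,
  -- orthogonal to `e`. In the basis `e, A' e`, `A` is diagonal and `A'` is the swap.
  obtain ⟨e, he, hnorm⟩ : ∃ e : Fin 2 → ℂ, A *ᵥ e = e ∧ star e ⬝ᵥ e = 1 := by
    obtain ⟨e, he, hker⟩ := Matrix.exists_mulVec_eq_zero_iff.2 hdet
    have hAe : A *ᵥ e = e := by
      rw [Matrix.sub_mulVec, Matrix.one_mulVec, sub_eq_zero] at hker
      exact hker.symm
    have hpos := Matrix.dotProduct_star_self_pos_iff.2 he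
    obtain ⟨hre, him⟩ := Complex.pos_iff.1 hpos
    have hval : star e ⬝ᵥ e = (((star e ⬝ᵥ e).re : ℝ) : ℂ) := Complex.ext rfl him.symm
    generalize (star e ⬝ᵥ e).re = r at hval hre
    have hr : ((√r : ℝ) : ℂ) * ((√r : ℝ) : ℂ) = r := by
      rw [← Complex.ofReal_mul, Real.mul_self_sqrt hre.le]
    have hr0 : ((√r : ℝ) : ℂ) ≠ 0 := by
      exact_mod_cast (Real.sqrt_pos.2 hre).ne'
    refine ⟨((√r : ℝ) : ℂ)⁻¹ • e, ?_, ?_⟩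
    · rw [Matrix.mulVec_smul, hAe]
    · rw [star_smul, smul_dotProduct, dotProduct_smul, hval, ← hr]
      simp
      field_simp
  have key : ∀ (M : QubitOp) (v w : Fin 2 → ℂ), Mᴴ = M → star (M *ᵥ v) ⬝ᵥ w = star v ⬝ᵥ (M *ᵥ w) := by
    intro M v w hM
    rw [Matrix.star_mulVec, hM, Matrix.dotProduct_mulVec]
  have hee : star e ⬝ᵥ (A' *ᵥ e) = 0 := by
    have h1 : star e ⬝ᵥ (A' *ᵥ e) = -(star e ⬝ᵥ (A' *ᵥ e)) := by
      conv_lhs => rw [← he, key A _ _ hA, Matrix.mulVec_mulVec, Matrix.mulVec_mulVec, hanti]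
      rw [Matrix.neg_mul, Matrix.mul_assoc, hsq, mul_one, Matrix.neg_mulVec, dotProduct_neg]
    exact self_eq_neg.1 h1
  have hee' : star (A' *ᵥ e) ⬝ᵥ e = 0 := by rw [key A' _ _ hA', hee]
  have hnorm' : star (A' *ᵥ e) ⬝ᵥ (A' *ᵥ e) = 1 := by
    rw [key A' _ _ hA', Matrix.mulVec_mulVec, hsq', Matrix.one_mulVec, hnorm]
  have hAe' : A *ᵥ (A' *ᵥ e) = -(A' *ᵥ e) := by
    rw [Matrix.mulVec_mulVec, hanti, Matrix.neg_mulVec, ← Matrix.mulVec_mulVec, he]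
  have hAe'' : A' *ᵥ (A' *ᵥ e) = e := by
    rw [Matrix.mulVec_mulVec, hsq', Matrix.one_mulVec]
  obtain ⟨f, hf⟩ : ∃ f, A' *ᵥ e = f := ⟨_, rfl⟩
  rw [hf] at hee hee' hnorm' hAe' hAe''
  let W : QubitOp := !![e 0, f 0; e 1, f 1]
  have hWW : Wᴴ * W = 1 := by
    ext i j
    simp only [dotProduct, Fin.sum_univ_two] at hnorm hee hee' hnorm'
    fin_cases i <;> fin_cases j <;> simp [W, Matrix.mul_apply]
    exacts [hnorm, hee, hee', hnorm']
  have hWW' : W * Wᴴ = 1 := mul_eq_one_comm.1 hWW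
  have hcol : ∀ (M : QubitOp) (g g' : Fin 2 → ℂ), M *ᵥ e = g → M *ᵥ f = g' →
      M * W = !![g 0, g' 0; g 1, g' 1] := by
    rintro M g g' rfl rfl
    ext i j
    fin_cases i <;> fin_cases j <;>
      simp [W, Matrix.mul_apply, Matrix.mulVec, dotProduct, Fin.sum_univ_two]
  refine ⟨Wᴴ, ?_, ?_, ?_⟩
  · rw [Matrix.mem_unitaryGroup_iff, Matrix.star_eq_conjTranspose,
      Matrix.conjTranspose_conjTranspose, hWW]
  · have : W * !![1, 0; 0, -1] = A * W := by
      rw [hcol A _ _ he hAe']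
      simp [W]
    rw [Matrix.conjTranspose_conjTranspose, this, Matrix.mul_assoc, hWW', mul_one]
  · have : W * !![0, 1; 1, 0] = A' * W := by
      rw [hcol A' _ _ hf hAe'']
      simp [W]
    rw [Matrix.conjTranspose_conjTranspose, this, Matrix.mul_assoc, hWW', mul_one]

theorem expect_conj (ρ : TwoQubitOp) (U V A B : QubitOp) :
    expect ρ (Uᴴ * A * U) (Vᴴ * B * V) = expect ((U ⊗ₖ V) * ρ * (U ⊗ₖ V)ᴴ) A B := by
  rw [expect_apply, expect_apply, Matrix.mul_kronecker_mul, Matrix.mul_kronecker_mul,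
    ← Matrix.conjTranspose_kronecker, Matrix.trace_mul_comm (A ⊗ₖ B), Matrix.mul_assoc,
    Matrix.mul_assoc, Matrix.trace_mul_comm]
  simp only [Matrix.mul_assoc]
  rw [Matrix.trace_mul_comm]
  simp only [Matrix.mul_assoc]

theorem ofReal_inv_sqrt_two_mul_self :
    ((√2 : ℝ) : ℂ)⁻¹ * ((√2 : ℝ) : ℂ)⁻¹ = 1 / 2 := by
  rw [← mul_inv, ← Complex.ofReal_mul, Real.mul_self_sqrt (by norm_num)]
  norm_num

theorem phiPlus_apply (i j : Fin 2) :
    phiPlus (i, j) = if i = j then ((√2 : ℝ) : ℂ)⁻¹ else 0 := by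
  fin_cases i <;> fin_cases j <;> simp [phiPlus, ket]

theorem phiPlus_quadratic_form (M : TwoQubitOp) :
    star phiPlus ⬝ᵥ (M *ᵥ phiPlus)
      = (M (0, 0) (0, 0) + M (0, 0) (1, 1) + M (1, 1) (0, 0) + M (1, 1) (1, 1)) / 2 := by
  simp [dotProduct, Matrix.mulVec, Fintype.sum_prod_type, Fin.sum_univ_two, phiPlus_apply]
  linear_combination (M (0, 0) (0, 0) + M (0, 0) (1, 1) + M (1, 1) (0, 0) + M (1, 1) (1, 1))
    * ofReal_inv_sqrt_two_mul_self

/-- The sum of two orthogonal correlations is at most twice the overlap with `|Φ⁺⟩`. -/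
theorem expect_pauli_add_le {M : TwoQubitOp} (hM : M.PosSemidef) :
    expect M !![1, 0; 0, -1] !![1, 0; 0, -1] + expect M !![0, 1; 1, 0] !![0, 1; 1, 0]
      ≤ 2 * (star phiPlus ⬝ᵥ (M *ᵥ phiPlus)).re := by
  -- The difference of the two sides is exactly this unnormalized singlet weight.
  have h := (Complex.le_def.1 (hM.dotProduct_mulVec_nonneg (ket 0 1 - ket 1 0))).1
  rw [phiPlus_quadratic_form]
  simp [dotProduct, Matrix.mulVec, Fintype.sum_prod_type, Fin.sum_univ_two, ket,
    Pi.single_apply] at h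
  simp [expect_apply, Matrix.trace, Matrix.mul_apply, Fintype.sum_prod_type, Fin.sum_univ_two]
  linarith

/-- Only two directions per side are prescribed, so orientation is no obstruction: local unitaries
carry both pairs to `(Z, X)`. -/
theorem expect_add_le_fullyEntangledFraction {ρ : TwoQubitOp} (hρ : IsState ρ)
    {a a' d d' : BlochSpace} (ha : ‖a‖ = 1) (ha' : ‖a'‖ = 1) (haa' : ⟪a, a'⟫ = 0)
    (hd : ‖d‖ = 1) (hd' : ‖d'‖ = 1) (hdd' : ⟪d, d'⟫ = 0) :
    expect ρ (bloch a) (bloch d) + expect ρ (bloch a') (bloch d')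
      ≤ 2 * fullyEntangledFraction ρ := by
  obtain ⟨U, hU, hUa, hUa'⟩ := exists_unitary_conj_eq_bloch ha ha' haa'
  obtain ⟨V, hV, hVd, hVd'⟩ := exists_unitary_conj_eq_bloch hd hd' hdd'
  rw [← hUa, ← hUa', ← hVd, ← hVd', expect_conj, expect_conj]
  refine (expect_pauli_add_le (hρ.posSemidef.mul_mul_conjTranspose_same _)).trans ?_
  exact mul_le_mul_of_nonneg_left
    ((isGreatest_fullyEntangledFraction ρ).2 ⟨U, hU, V, hV, rfl⟩) zero_le_two

/-! ### The upper bound -/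

/-- The non-locality is bounded in terms of the fully entangled fraction. -/
theorem nonLocality_le {ρ : TwoQubitOp} (hρ : IsState ρ) {m : ℝ} (hm : 0 ≤ m)
    (hF : 2 * fullyEntangledFraction ρ - 1 ≤ m) : nonLocality ρ ≤ 2 * √(1 + m ^ 2) := by
  have hC : 1 ≤ 1 + m ^ 2 := by nlinarith
  obtain ⟨A₀, A₁, B₀, B₁, hA₀, hA₁, hB₀, hB₁, hle⟩ :=
    exists_chshExpect_ge (isGreatest_nonLocality ρ).1
  refine hle.trans ?_
  rcases chshExpect_le_two_or hρ hA₀ hA₁ hB₀ hB₁ with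
    h | ⟨a₀, a₁, b₀, b₁, ha₀, ha₁, hb₀, hb₁, rfl, rfl, rfl, rfl⟩
  · have := Real.one_le_sqrt.2 hC
    linarith
  obtain ⟨T, hT⟩ := exists_correlationMap ρ
  have hT₁ : ∀ d, ‖d‖ = 1 → ‖T d‖ ≤ 1 := by
    intro d hd
    rcases eq_or_ne (T d) 0 with h | h
    · simp [h]
    -- `‖T d‖` is itself a correlation, with Alice measuring along `T d`.
    have hn : ‖‖T d‖⁻¹ • T d‖ = 1 := norm_smul_inv_norm h
    have := (abs_le.1 (abs_expect_le_one hρ (Or.inr (Or.inr ⟨_, hn, rfl⟩))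
      (Or.inr (Or.inr ⟨d, hd, rfl⟩)))).2
    rwa [hT, real_inner_smul_left, real_inner_self_eq_norm_sq, pow_two,
      inv_mul_cancel_left₀ (norm_ne_zero_iff.2 h)] at this
  have hT₂ : ∀ c c', ‖c‖ = 1 → ‖c'‖ = 1 → ⟪c, c'⟫ = 0 →
      ‖T c‖ ^ 2 + ‖T c'‖ ^ 2 ≤ 1 + m ^ 2 := by
    intro c c' hc hc' hcc'
    refine norm_sq_map_add_norm_sq_map_le T hm hT₁ ?_ hc hc' hcc'
    intro a a' d d' ha ha' haa' hd hd' hdd'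
    rw [← hT, ← hT]
    linarith [expect_add_le_fullyEntangledFraction hρ ha ha' haa' hd hd' hdd']
  have := inner_map_add_sub_le T hC hT₁ hT₂ ha₀ ha₁ hb₀ hb₁
  rw [map_add, map_sub, inner_add_right, inner_sub_right] at this
  simp only [chshExpect, hT]
  linarith

/-! ### The states `Ω_α` -/

theorem Omega_apply (α : ℝ) (i j k l : Fin 2) : Omega α (i, j) (k, l)
    = if i = j ∧ k = l then (if i = k then 1 / 2 else (α : ℂ) / 2) else 0 := by
  have h := ofReal_inv_sqrt_two_mul_self
  fin_cases i <;> fin_cases j <;> fin_cases k <;> fin_cases l <;>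
    simp [Omega, ketbra, ket, phiPlus_apply, Matrix.vecMulVec_apply, -mul_eq_mul_left_iff] <;>
    linear_combination (α : ℂ) * h

/-- The columnwise bilinear products of two unitaries lie in the unit disc. -/
theorem normSq_col_mul_col_le_one {U V : QubitOp} (hU : U ∈ Matrix.unitaryGroup (Fin 2) ℂ)
    (hV : V ∈ Matrix.unitaryGroup (Fin 2) ℂ) (j : Fin 2) :
    Complex.normSq (U 0 j * V 0 j + U 1 j * V 1 j) ≤ 1 := by
  have col : ∀ W ∈ Matrix.unitaryGroup (Fin 2) ℂ, ‖W 0 j‖ ^ 2 + ‖W 1 j‖ ^ 2 = 1 := by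
    intro W hW
    have h := congrFun (congrFun (Matrix.mem_unitaryGroup_iff'.1 hW) j) j
    simp only [Matrix.mul_apply, Fin.sum_univ_two, Matrix.star_apply, Matrix.one_apply_eq,
      RCLike.star_def, ← Complex.normSq_eq_conj_mul_self, Complex.normSq_eq_norm_sq] at h
    exact_mod_cast h
  have hu := col U hU
  have hv := col V hV
  have htri := norm_add_le (U 0 j * V 0 j) (U 1 j * V 1 j)
  rw [norm_mul, norm_mul] at htri
  have hle : ‖U 0 j * V 0 j + U 1 j * V 1 j‖ ≤ 1 := by
    nlinarith [sq_nonneg (‖U 0 j‖ - ‖V 0 j‖), sq_nonneg (‖U 1 j‖ - ‖V 1 j‖)]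
  rw [Complex.normSq_eq_norm_sq]
  exact pow_le_one₀ (norm_nonneg _) hle

/-- The amplitude of `(U ⊗ V)|jj⟩` along `Φ⁺` is `(∑ i, U i j * V i j) / √2`; these add coherently
in the `Φ⁺` component and incoherently in the other two. -/
theorem overlap_Omega (α : ℝ) (U V : QubitOp) : overlap (Omega α) U V
    = α / 4 * Complex.normSq ((U 0 0 * V 0 0 + U 1 0 * V 1 0) + (U 0 1 * V 0 1 + U 1 1 * V 1 1))
      + (1 - α) / 4 * (Complex.normSq (U 0 0 * V 0 0 + U 1 0 * V 1 0)
        + Complex.normSq (U 0 1 * V 0 1 + U 1 1 * V 1 1)) := by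
  rw [overlap, phiPlus_quadratic_form]
  simp [Matrix.mul_apply, Matrix.conjTranspose_apply, Fintype.sum_prod_type, Fin.sum_univ_two,
    Omega_apply, Complex.normSq_apply]
  ring

/-- Only this inequality is needed: it turns `F(ρ) ≤ F(Ω_α)` into `2F(ρ) - 1 ≤ α`. -/
theorem fullyEntangledFraction_Omega_le {α : ℝ} (h₀ : 0 ≤ α) (h₁ : α ≤ 1) :
    fullyEntangledFraction (Omega α) ≤ (1 + α) / 2 := by
  obtain ⟨U, hU, V, hV, h⟩ := (isGreatest_fullyEntangledFraction (Omega α)).1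
  rw [h, overlap_Omega]
  have hz := normSq_col_mul_col_le_one hU hV 0
  have hw := normSq_col_mul_col_le_one hU hV 1
  generalize U 0 0 * V 0 0 + U 1 0 * V 1 0 = z at *
  generalize U 0 1 * V 0 1 + U 1 1 * V 1 1 = w at *
  have hzw : Complex.normSq (z + w) ≤ 4 := by
    rw [Complex.normSq_apply] at *
    simp only [Complex.add_re, Complex.add_im]
    nlinarith [sq_nonneg (z.re - w.re), sq_nonneg (z.im - w.im)]
  nlinarith

/-- The projective measurement of the observable `v · σ`. -/
def projective (v : BlochSpace) : Fin 2 → QubitOp :=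
  ![((1 / 2 : ℝ) : ℂ) • (1 + bloch v), ((1 / 2 : ℝ) : ℂ) • (1 + bloch (-v))]

theorem isMeasurement_projective {v : BlochSpace} (hv : ‖v‖ = 1) :
    IsMeasurement (projective v) := by
  have hc : (0 : ℂ) ≤ ((1 / 2 : ℝ) : ℂ) := by
    exact_mod_cast (by norm_num : (0 : ℝ) ≤ 1 / 2)
  constructor
  · intro a
    fin_cases a
    · exact (posSemidef_one_add_bloch hv).smul hc
    · exact (posSemidef_one_add_bloch (by rwa [norm_neg])).smul hc
  · simp only [projective, Fin.sum_univ_two, Matrix.cons_val_zero, Matrix.cons_val_one, map_neg]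
    push_cast
    module

theorem projective_sub (v : BlochSpace) : projective v 0 - projective v 1 = bloch v := by
  simp only [projective, Matrix.cons_val_zero, Matrix.cons_val_one, map_neg]
  push_cast
  module

theorem expect_Omega (α : ℝ) (v w : BlochSpace) :
    expect (Omega α) (bloch v) (bloch w) = α * (v 0 * w 0 - v 1 * w 1) + v 2 * w 2 := by
  simp [expect_apply, Matrix.trace, Matrix.mul_apply, Fintype.sum_prod_type, Fin.sum_univ_two,
    Omega_apply, bloch_apply]
  ring

theorem le_nonLocality_Omega (α : ℝ) : 2 * √(1 + α ^ 2) ≤ nonLocality (Omega α) := by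
  have hpos : 0 < 1 + α ^ 2 := by positivity
  have hs : √(1 + α ^ 2) * √(1 + α ^ 2) = 1 + α ^ 2 := Real.mul_self_sqrt hpos.le
  have hs0 : √(1 + α ^ 2) ≠ 0 := (Real.sqrt_pos.2 hpos).ne'
  set s := √(1 + α ^ 2)
  have unit : ∀ x z : ℝ, x ^ 2 + z ^ 2 = 1 → ‖(!₂[x, 0, z] : BlochSpace)‖ = 1 := by
    intro x z h
    rw [← sq_eq_sq₀ (norm_nonneg _) zero_le_one, norm_sq_eq_sum]
    simpa using h
  have hB : ∀ ε : ℝ, ε ^ 2 = 1 → (ε * (α / s)) ^ 2 + (1 / s) ^ 2 = 1 := by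
    intro ε hε
    field_simp
    rw [hε, pow_two s, hs]
    ring
  -- Alice measures along `z` and `x`, the directions of singular values 1 and `α`; Bob's `(±α, 0,
  -- 1)/s` maximize the resulting sum, `2 (1 + α²)/s = 2s`.
  let A : Fin 2 → BlochSpace := ![!₂[0, 0, 1], !₂[1, 0, 0]]
  let B : Fin 2 → BlochSpace := ![!₂[1 * (α / s), 0, 1 / s], !₂[-1 * (α / s), 0, 1 / s]]
  have hA : ∀ x, ‖A x‖ = 1 := by
    intro x
    fin_cases x
    · exact unit _ _ (by norm_num)
    · exact unit _ _ (by norm_num)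
  have hB : ∀ y, ‖B y‖ = 1 := by
    intro y
    fin_cases y
    · exact unit _ _ (hB _ (by norm_num))
    · exact unit _ _ (hB _ (by norm_num))
  refine (isGreatest_nonLocality (Omega α)).2 ⟨fun x => projective (A x),
    fun y => projective (B y), fun x => isMeasurement_projective (hA x),
    fun y => isMeasurement_projective (hB y), ?_⟩
  simp only [chsh, correlation_behavior, projective_sub, expect_Omega]
  simp [A, B]
  field_simp
  linear_combination 2 * hs

end TwoQubit

end

theorem mainTheorem5 (ρ : TwoQubit.TwoQubitOp) (hρ : TwoQubit.IsState ρ) :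
    (1 / 2 ≤ TwoQubit.fullyEntangledFraction ρ → TwoQubit.fullyEntangledFraction ρ ≤ 1 →
      TwoQubit.nonLocality ρ
        ≤ 2 * √(1 + (2 * TwoQubit.fullyEntangledFraction ρ - 1) ^ 2)) ∧
    (∀ α : ℝ, 0 ≤ α → α ≤ 1 →
      TwoQubit.fullyEntangledFraction ρ
        ≤ TwoQubit.fullyEntangledFraction (TwoQubit.Omega α) →
      TwoQubit.nonLocality ρ ≤ TwoQubit.nonLocality (TwoQubit.Omega α)) := by
  -- The first part takes `m = 2F(ρ) - 1`, the second `m = α`, which also covers `F(ρ) < 1/2`.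
  refine ⟨fun h _ => TwoQubit.nonLocality_le hρ (by linarith) le_rfl, fun α h₀ h₁ hF => ?_⟩
  have := TwoQubit.fullyEntangledFraction_Omega_le h₀ h₁
  exact (TwoQubit.nonLocality_le hρ h₀ (by linarith)).trans (TwoQubit.le_nonLocality_Omega α)
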